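/- Let $1\le d'\le d$ and $n\ge 1$, and let $X$ be a random vector in $\mathbb R^d$ that is sub-Gaussian with constant $C_{sg}\ge 0$: $\mathbb E\|X\|^2<\infty$ and $$\sup_{k\ge 1} k^{-1/2}\,\mathbb E\big[|X\cdot u|^k\big]^{1/k}\le C_{sg}\,\mathbb E\big[(X\cdot u)^2\big]^{1/2}\qquad\text{for all }u\in\mathbb R^d,$$ where $k$ ranges over the positive integers. Let $\Sigma=\mathbb E[XX^{\top}]$ (the covariance matrix of $X$ when $X$ is centred), with eigenvalues $\lambda_1\ge\dots\ge\lambda_d$, and put $\lambda_{d+1}:=0$. For a $d\times d$ matrix $P$ let $R(P)=\mathbb E\|X-PX\|^2$. Let $X_1,\dots,X_n$ be i.i.d. copies of $X$, let $\widehat\Sigma=\frac1n\sum_{k=1}^n X_kX_k^{\top}$, and let $\widehat P_{d'}=\sum_{i\le d'}\hat v_i\hat v_i^{\top}$, where $\hat v_1,\dots,\hat v_d$ is an orthonormal basis of eigenvectors of $\widehat\Sigma$ listed in order of non-increasing eigenvalues (any choice of such eigenvectors that makes $\widehat P_{d'}$ a measurable random matrix). If $\varepsilon\ge 0$ and $\lambda_{d'+1}\le\varepsilon$,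 then $R(\widehat P_{d'})$ is integrable and $$\mathbb E\big[R(\widehat P_{d'})\big]\le\min\left(\frac{8C_{sg}^2\sqrt{d'}\,\operatorname{tr}(\Sigma)}{\sqrt n},\ \frac{64\,C_{sg}^4\,\operatorname{tr}^2(\Sigma)}{n(\lambda_{d'}-\lambda_{d'+1})}\right)+\varepsilon\,(d-d'),$$ where the second term of the minimum is omitted (read as $+\infty$) if $\lambda_{d'}=\lambda_{d'+1}$. -/

import Mathlib

open MeasureTheory ProbabilityTheory
open scoped ENNReal NNReal

namespace PCA

/-- Sub-Gaussianity of a random vector `X` with constant `C`: finite second moment, and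
`sup_{k ≥ 1} k^{-1/2} E[|X·u|^k]^{1/k} ≤ C E[(X·u)^2]^{1/2}` for every direction `u`.
The moments are taken in `[0, ∞]`, so the inequality includes their finiteness. -/
structure IsSubGaussian {d : ℕ} {Ω : Type*} [MeasurableSpace Ω]
    (X : Ω → EuclideanSpace ℝ (Fin d)) (C : ℝ≥0) (μ : Measure Ω) : Prop where
  memLp_two : MemLp X 2 μ
  moment_le : ∀ u : EuclideanSpace ℝ (Fin d),
    (⨆ (k : ℕ) (_ : 1 ≤ k), ENNReal.ofReal ((k : ℝ) ^ (-(1 / 2) : ℝ)) *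
        eLpNorm (fun ω => inner ℝ (X ω) u) (k : ℝ≥0∞) μ)
      ≤ (C : ℝ≥0∞) * eLpNorm (fun ω => inner ℝ (X ω) u) 2 μ

/-- The matrix `Σ = E[X Xᵀ]`; it is the covariance matrix when `X` is centred
(`secondMoment_eq_cov`). -/
noncomputable def secondMoment {d : ℕ} {Ω : Type*} [MeasurableSpace Ω]
    (X : Ω → EuclideanSpace ℝ (Fin d)) (μ : Measure Ω) : Matrix (Fin d) (Fin d) ℝ :=
  Matrix.of fun i j => ∫ ω, X ω i * X ω j ∂μ

theorem secondMoment_isHermitian {d : ℕ} {Ω : Type*} [MeasurableSpace Ω]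
    (X : Ω → EuclideanSpace ℝ (Fin d)) (μ : Measure Ω) :
    (secondMoment X μ).IsHermitian := by
  ext i j
  simp [secondMoment, mul_comm]

theorem secondMoment_eq_cov {d : ℕ} {Ω : Type*} [MeasurableSpace Ω]
    (X : Ω → EuclideanSpace ℝ (Fin d)) (μ : Measure Ω)
    (h0 : ∀ i, ∫ ω, X ω i ∂μ = 0) (i j : Fin d) :
    secondMoment X μ i j = cov[fun ω => X ω i, fun ω => X ω j; μ] := by
  simp [secondMoment, covariance, h0]

/-- The empirical matrix `(1/n) ∑ X_k X_kᵀ` of the sample `x`. -/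
noncomputable def empiricalSecondMoment {d n : ℕ}
    (x : Fin n → EuclideanSpace ℝ (Fin d)) : Matrix (Fin d) (Fin d) ℝ :=
  Matrix.of fun i j => (n : ℝ)⁻¹ * ∑ k, x k i * x k j

/-- The `i`-th largest eigenvalue (`i = 1, …, d`, with multiplicity) of a symmetric matrix,
and `0` for `i` outside this range. -/
noncomputable def eigenvalue {d : ℕ} {A : Matrix (Fin d) (Fin d) ℝ} (hA : A.IsHermitian)
    (i : ℕ) : ℝ :=
  if h : 1 ≤ i ∧ i ≤ d then
    hA.eigenvalues₀ ⟨i - 1, by rw [Fintype.card_fin]; omega⟩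
  else 0

/-- The expected projection error `R(P) = E‖X - P X‖²` of a fixed matrix `P`. -/
noncomputable def risk {d : ℕ} {Ω : Type*} [MeasurableSpace Ω]
    (X : Ω → EuclideanSpace ℝ (Fin d)) (μ : Measure Ω) (P : Matrix (Fin d) (Fin d) ℝ) : ℝ :=
  ∫ ω, ‖X ω - Matrix.toEuclideanLin P (X ω)‖ ^ 2 ∂μ

/-- `P` is a rank-`m` PCA projector of the symmetric matrix `A`: there is an orthonormal basis
`v` of eigenvectors of `A`, listed by non-increasing eigenvalue `l`, such that `P` is the
orthogonal projector `∑_{i ≤ m} v_i v_iᵀ` on the span of the first `m` of them. (If the `m`-th and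
`(m+1)`-st eigenvalues coincide, there are several such `P`.) -/
def IsPCAProjector {d : ℕ} (A : Matrix (Fin d) (Fin d) ℝ) (m : ℕ)
    (P : Matrix (Fin d) (Fin d) ℝ) : Prop :=
  ∃ (v : OrthonormalBasis (Fin d) ℝ (EuclideanSpace ℝ (Fin d))) (l : Fin d → ℝ),
    Antitone l ∧ (∀ i, Matrix.toEuclideanLin A (v i) = l i • v i) ∧
    P = ∑ i : Fin d with i.val < m, Matrix.vecMulVec (v i).ofLp (v i).ofLp

end PCA

/-! Write `A` for the second-moment matrix, `B` for its empirical version, `P` and `Q` for their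
leading rank-`m` projectors, `m = d'`. The risk of a projector is linear in it, so the risk of `Q`
is the bias `tr A - tr (P A)`, a sum of tail eigenvalues each at most `ε`, plus the excess `x = tr
(P A) - tr (Q A)`.

Since `Q` maximises the trace against `B`, `x ≤ tr ((B - A) (Q - P))`, and Cauchy–Schwarz gives `x²
≤ F * 2 (m - tr (Q P))` with `F` the squared Frobenius norm of `B - A` (`excess_sq_le`). Dropping
`tr (Q P) ≥ 0` yields the slow rate. For the fast rate, a quantitative Ky Fan inequality
(`mul_gap_le_trace_sub`) bounds `gap * (m - tr (Q P))` by `x` itself, so one factor `x` cancels and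
`x ≤ 2 F / gap`.

It remains to bound `E F` (`integral_frobSq_le`): sub-Gaussianity at `k = 4` controls the variance
of each entry of `B`. -/

namespace PCA

open Matrix

/-! ### Traces, spectral projectors and perturbation. -/

section Deterministic

variable {d : ℕ}

/-- The orthogonal projector on the span of the first `m` vectors of an orthonormal basis. -/
noncomputable def headProjector
    (v : OrthonormalBasis (Fin d) ℝ (EuclideanSpace ℝ (Fin d))) (m : ℕ) :
    Matrix (Fin d) (Fin d) ℝ :=
  ∑ i : Fin d with i.val < m, vecMulVec (v i).ofLp (v i).ofLp

variable (u v : OrthonormalBasis (Fin d) ℝ (EuclideanSpace ℝ (Fin d))) {m : ℕ}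

theorem basis_dotProduct (i j : Fin d) :
    (v i).ofLp ⬝ᵥ (v j).ofLp = if i = j then 1 else 0 := by
  have h := orthonormal_iff_ite.mp v.orthonormal j i
  rw [EuclideanSpace.inner_eq_star_dotProduct] at h
  simpa [eq_comm] using h

theorem sum_vecMulVec_basis : ∑ i, vecMulVec (v i).ofLp (v i).ofLp = 1 := by
  ext a b
  have h := v.sum_inner_mul_inner (EuclideanSpace.single a (1 : ℝ)) (EuclideanSpace.single b 1)
  simp only [EuclideanSpace.inner_single_left, EuclideanSpace.inner_single_right] at h
  simp only [Matrix.sum_apply, vecMulVec_apply, Matrix.one_apply]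
  simpa [PiLp.single_apply, eq_comm] using h

theorem trace_mul_vecMulVec (M : Matrix (Fin d) (Fin d) ℝ) (a b : Fin d → ℝ) :
    (M * vecMulVec a b).trace = b ⬝ᵥ M *ᵥ a := by
  rw [mul_vecMulVec, trace_vecMulVec, dotProduct_comm]

theorem trace_eq_sum_basis (M : Matrix (Fin d) (Fin d) ℝ) :
    M.trace = ∑ i, (v i).ofLp ⬝ᵥ M *ᵥ (v i).ofLp := by
  conv_lhs => rw [← mul_one M, ← sum_vecMulVec_basis v, Finset.mul_sum, trace_sum]
  simp only [trace_mul_vecMulVec]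

theorem headProjector_transpose : (headProjector v m)ᵀ = headProjector v m := by
  simp [headProjector, transpose_sum, transpose_vecMulVec]

theorem headProjector_mulVec (i : Fin d) :
    headProjector v m *ᵥ (v i).ofLp = if i.val < m then (v i).ofLp else 0 := by
  simp only [headProjector, sum_mulVec, vecMulVec_mulVec, basis_dotProduct]
  simp

theorem headProjector_mul_self :
    headProjector v m * headProjector v m = headProjector v m := by
  conv_lhs => enter [2]; rw [headProjector]
  rw [Finset.mul_sum, headProjector]
  refine Finset.sum_congr rfl fun i hi => ?_
  rw [mul_vecMulVec, ← headProjector, headProjector_mulVec, if_pos (by simpa using hi)]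

theorem trace_headProjector (hm : m ≤ d) : (headProjector v m).trace = m := by
  rw [trace_eq_sum_basis v]
  simp only [headProjector_mulVec]
  have : ∀ i : Fin d, (v i).ofLp ⬝ᵥ (if i.val < m then (v i).ofLp else 0)
      = if i.val < m then 1 else 0 := by
    intro i
    split_ifs <;> simp [basis_dotProduct]
  simp only [this, Finset.sum_boole, Fin.card_filter_val_lt]
  simp [hm]

theorem dotProduct_headProjector (x : Fin d → ℝ) :
    x ⬝ᵥ headProjector v m *ᵥ x = ∑ i : Fin d with i.val < m, (x ⬝ᵥ (v i).ofLp) ^ 2 := by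
  simp only [headProjector, sum_mulVec, dotProduct_sum, vecMulVec_mulVec]
  refine Finset.sum_congr rfl fun i _ => ?_
  simp [dotProduct_comm x, sq]

theorem dotProduct_headProjector_nonneg (x : Fin d → ℝ) :
    0 ≤ x ⬝ᵥ headProjector v m *ᵥ x := by
  rw [dotProduct_headProjector]
  positivity

theorem dotProduct_headProjector_le (x : Fin d → ℝ) :
    x ⬝ᵥ headProjector v m *ᵥ x ≤ x ⬝ᵥ x := by
  have h : x ⬝ᵥ x = ∑ i, (x ⬝ᵥ (v i).ofLp) ^ 2 := by
    conv_lhs => enter [2]; rw [← one_mulVec x, ← sum_vecMulVec_basis v]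
    simp only [sum_mulVec, dotProduct_sum, vecMulVec_mulVec]
    refine Finset.sum_congr rfl fun i _ => ?_
    simp [dotProduct_comm x, sq]
  rw [h, dotProduct_headProjector]
  exact Finset.sum_le_sum_of_subset_of_nonneg (Finset.filter_subset _ _)
    fun _ _ _ => sq_nonneg _

theorem trace_mul_headProjector_nonneg :
    0 ≤ (headProjector u m * headProjector v m).trace := by
  conv_rhs => enter [1, 2]; rw [headProjector]
  rw [Finset.mul_sum, trace_sum]
  refine Finset.sum_nonneg fun i _ => ?_
  rw [trace_mul_vecMulVec]
  exact dotProduct_headProjector_nonneg _ _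

variable {v} {A : Matrix (Fin d) (Fin d) ℝ} {l : Fin d → ℝ}

theorem trace_mul_eigenbasis (hA : ∀ i, A *ᵥ (v i).ofLp = l i • (v i).ofLp)
    (M : Matrix (Fin d) (Fin d) ℝ) :
    (M * A).trace = ∑ i, l i * ((v i).ofLp ⬝ᵥ M *ᵥ (v i).ofLp) := by
  rw [trace_eq_sum_basis v]
  refine Finset.sum_congr rfl fun i _ => ?_
  rw [← mulVec_mulVec, hA, mulVec_smul, dotProduct_smul, smul_eq_mul]

theorem trace_sub_headProjector_mul (hA : ∀ i, A *ᵥ (v i).ofLp = l i • (v i).ofLp) :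
    A.trace - (headProjector v m * A).trace = ∑ i : Fin d with ¬ i.val < m, l i := by
  rw [trace_mul_eigenbasis hA, ← one_mul A, trace_mul_eigenbasis hA, ← Finset.sum_sub_distrib,
    Finset.sum_filter]
  refine Finset.sum_congr rfl fun i _ => ?_
  rw [headProjector_mulVec, one_mulVec]
  split_ifs <;> simp_all [basis_dotProduct]

/-- Quantitative Ky Fan inequality: the leading spectral projector maximises `tr (P A)`. -/
theorem mul_gap_le_trace_sub (hm : m ≤ d) (hA : ∀ i, A *ᵥ (v i).ofLp = l i • (v i).ofLp)
    {a b : ℝ} (ha : ∀ i : Fin d, i.val < m → a ≤ l i) (hb : ∀ i : Fin d, m ≤ i.val → l i ≤ b) :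
    (a - b) * (m - (headProjector u m * headProjector v m).trace)
      ≤ (headProjector v m * A).trace - (headProjector u m * A).trace := by
  -- The diagonal of the competitor in the eigenbasis: weights in `[0, 1]` of total mass `m`. Ky Fan
  -- thus reduces to comparing weighted sums of eigenvalues.
  set q : Fin d → ℝ := fun i => (v i).ofLp ⬝ᵥ headProjector u m *ᵥ (v i).ofLp with hq
  have hq0 : ∀ i, 0 ≤ q i := fun i => dotProduct_headProjector_nonneg u _
  have hq1 : ∀ i, q i ≤ 1 := fun i => by
    simpa [basis_dotProduct] using dotProduct_headProjector_le (m := m) u (v i).ofLp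
  have hqs : ∑ i, q i = m := by
    rw [← trace_headProjector u hm, trace_eq_sum_basis v]
  have hpq : (headProjector u m * headProjector v m).trace
      = ∑ i : Fin d, if i.val < m then q i else 0 := by
    rw [trace_mul_eigenbasis (v := v) (l := fun i => if i.val < m then 1 else 0)]
    · exact Finset.sum_congr rfl fun i _ => by split_ifs <;> simp [hq]
    · intro i
      rw [headProjector_mulVec]
      split_ifs <;> simp
  have hone : (m : ℝ) = ∑ i : Fin d, if i.val < m then 1 else 0 := by
    rw [Finset.sum_boole, Fin.card_filter_val_lt]
    simp [hm]
  have hlhs : (a - b) * (m - (headProjector u m * headProjector v m).trace)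
      = ∑ i : Fin d, if i.val < m then a * (1 - q i) else - (b * q i) := by
    -- The mass constraint lets `b` multiply exactly the weight lying outside the head, making the
    -- comparison termwise.
    have h1 : (a - b) * (m - (headProjector u m * headProjector v m).trace)
        = a * (m - (headProjector u m * headProjector v m).trace)
          - b * (∑ i, q i - (headProjector u m * headProjector v m).trace) := by
      rw [hqs]; ring
    rw [h1, hpq, hone, ← Finset.sum_sub_distrib, ← Finset.sum_sub_distrib, Finset.mul_sum,
      Finset.mul_sum, ← Finset.sum_sub_distrib]
    exact Finset.sum_congr rfl fun i _ => by split_ifs <;> ring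
  rw [hlhs, trace_mul_eigenbasis hA, trace_mul_eigenbasis hA, ← Finset.sum_sub_distrib]
  refine Finset.sum_le_sum fun i _ => ?_
  rw [headProjector_mulVec]
  change _ ≤ _ - l i * q i
  split_ifs with h
  · rw [basis_dotProduct, if_pos rfl]
    nlinarith [ha i h, hq1 i]
  · rw [dotProduct_zero]
    nlinarith [hb i (not_lt.mp h), hq0 i]

/-- The squared Frobenius norm. -/
def frobSq (M : Matrix (Fin d) (Fin d) ℝ) : ℝ := ∑ i, ∑ j, M i j ^ 2

theorem frobSq_nonneg (M : Matrix (Fin d) (Fin d) ℝ) : 0 ≤ frobSq M := by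
  unfold frobSq
  positivity

/-- Cauchy–Schwarz for the Frobenius pairing; symmetry of `N` turns the trace into an entrywise sum.
-/
theorem trace_mul_sq_le (M N : Matrix (Fin d) (Fin d) ℝ) (hN : Nᵀ = N) :
    (M * N).trace ^ 2 ≤ frobSq M * frobSq N := by
  have h : (M * N).trace = ∑ p : Fin d × Fin d, M p.1 p.2 * N p.1 p.2 := by
    rw [Fintype.sum_prod_type]
    simp only [trace, diag_apply, mul_apply]
    refine Finset.sum_congr rfl fun i _ => Finset.sum_congr rfl fun j _ => ?_
    conv_lhs => rw [← hN, transpose_apply]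
  rw [h]
  simpa only [frobSq, Fintype.sum_prod_type] using
    Finset.sum_mul_sq_le_sq_mul_sq Finset.univ (fun p : Fin d × Fin d => M p.1 p.2)
      (fun p => N p.1 p.2)

variable (v) in
theorem frobSq_headProjector_sub (hm : m ≤ d) :
    frobSq (headProjector v m - headProjector u m)
      = 2 * (m - (headProjector u m * headProjector v m).trace) := by
  set P := headProjector v m
  set Q := headProjector u m
  have h : frobSq (P - Q) = ((P - Q) * (P - Q)ᵀ).trace := by
    simp [frobSq, trace, mul_apply, sq]
  rw [h, transpose_sub, headProjector_transpose, headProjector_transpose, sub_mul, mul_sub,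
    mul_sub, headProjector_mul_self, headProjector_mul_self, trace_sub, trace_sub, trace_sub,
    trace_headProjector v hm, trace_headProjector u hm, trace_mul_comm P Q]
  ring

variable {u} {B : Matrix (Fin d) (Fin d) ℝ} {l' : Fin d → ℝ}

/-- The excess risk is controlled by the perturbation and the distance of the projectors. -/
theorem excess_sq_le (hm0 : 1 ≤ m) (hm : m ≤ d)
    (hl : Antitone l) (hA : ∀ i, A *ᵥ (v i).ofLp = l i • (v i).ofLp)
    (hl' : Antitone l') (hB : ∀ i, B *ᵥ (u i).ofLp = l' i • (u i).ofLp) :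
    0 ≤ (headProjector v m * A).trace - (headProjector u m * A).trace ∧
    ((headProjector v m * A).trace - (headProjector u m * A).trace) ^ 2
      ≤ frobSq (B - A) * (2 * (m - (headProjector u m * headProjector v m).trace)) := by
  have key : ∀ {C : Matrix (Fin d) (Fin d) ℝ} {k : Fin d → ℝ}
      (w w' : OrthonormalBasis (Fin d) ℝ (EuclideanSpace ℝ (Fin d))), Antitone k →
      (∀ i, C *ᵥ (w i).ofLp = k i • (w i).ofLp) →
      0 ≤ (headProjector w m * C).trace - (headProjector w' m * C).trace := by
    intro C k w w' hk hC
    -- With `a = b` equal to the `m`-th eigenvalue (index `m - 1`, whence `1 ≤ m`) the gap term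
    -- vanishes, leaving the plain Ky Fan inequality.
    have := mul_gap_le_trace_sub w' hm hC (a := k ⟨m - 1, by omega⟩) (b := k ⟨m - 1, by omega⟩)
      (fun i hi => hk (Fin.mk_le_mk.mpr (by omega : i.val ≤ m - 1)))
      (fun i hi => hk (Fin.mk_le_mk.mpr (by omega : m - 1 ≤ i.val)))
    simpa using this
  have h0 := key v u hl hA
  have h1 := key u v hl' hB
  refine ⟨h0, ?_⟩
  -- The right side is the excess for `A` plus the excess for `B` in the opposite direction, which
  -- `h1` makes nonnegative.
  have h2 : (headProjector v m * A).trace - (headProjector u m * A).trace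
      ≤ ((B - A) * (headProjector u m - headProjector v m)).trace := by
    rw [trace_mul_comm (B - A)]
    simp only [sub_mul, mul_sub, trace_sub]
    linarith
  calc _ ≤ ((B - A) * (headProjector u m - headProjector v m)).trace ^ 2 :=
        pow_le_pow_left₀ h0 h2 2
    _ ≤ _ := trace_mul_sq_le _ _ (by simp [headProjector_transpose])
    _ = _ := by rw [frobSq_headProjector_sub v u hm, trace_mul_comm]

/-- A symmetric matrix has an orthonormal eigenbasis listed by its decreasing eigenvalues. -/
theorem exists_sorted_eigenbasis (hA : A.IsHermitian) :
    ∃ (v : OrthonormalBasis (Fin d) ℝ (EuclideanSpace ℝ (Fin d))) (l : Fin d → ℝ),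
      Antitone l ∧ (∀ i, A *ᵥ (v i).ofLp = l i • (v i).ofLp) ∧
      ∀ i : Fin d, eigenvalue hA (i + 1) = l i := by
  -- The equivalence through which `eigenvalues` is indexed; reindexing by it restores the sorted
  -- order of `eigenvalues₀`.
  let e : Fin (Fintype.card (Fin d)) ≃ Fin d := Fintype.equivOfCardEq (Fintype.card_fin _)
  let c : Fin d → Fin (Fintype.card (Fin d)) := Fin.cast (Fintype.card_fin d).symm
  refine ⟨hA.eigenvectorBasis.reindex (e.symm.trans (finCongr (Fintype.card_fin d))),
    fun i => hA.eigenvalues₀ (c i), fun i j h => hA.eigenvalues₀_antitone h, fun i => ?_,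
    fun i => ?_⟩
  · have h := hA.mulVec_eigenvectorBasis (e (c i))
    have h' : hA.eigenvalues (e (c i)) = hA.eigenvalues₀ (c i) := by
      simp [IsHermitian.eigenvalues, e]
    rw [h'] at h
    simpa [OrthonormalBasis.reindex_apply] using h
  · have : 1 ≤ i.val + 1 ∧ i.val + 1 ≤ d := by omega
    rw [eigenvalue, dif_pos this]
    rfl

end Deterministic

end PCA

namespace PCA

open Matrix

/-! ### Risk as a trace, and fourth moments. -/

section Probability

variable {d : ℕ} {Ω₀ : Type*} [MeasurableSpace Ω₀] {μ : Measure Ω₀}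
  {X : Ω₀ → EuclideanSpace ℝ (Fin d)} {C : ℝ≥0}

theorem memLp_coord {p : ℝ≥0∞} (h : MemLp X p μ) (i : Fin d) : MemLp (fun ω => X ω i) p μ :=
  h.continuousLinearMap_comp (EuclideanSpace.proj (𝕜 := ℝ) i)

theorem integrable_coord_mul (h : MemLp X 2 μ) (i j : Fin d) :
    Integrable (fun ω => X ω i * X ω j) μ :=
  (memLp_coord h i).integrable_mul (memLp_coord h j)

/-- The complementary projector is symmetric and idempotent, so the squared norm is its quadratic
form, linear in the products `x j * x i`. -/
theorem norm_sub_headProjector_sq (v : OrthonormalBasis (Fin d) ℝ (EuclideanSpace ℝ (Fin d)))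
    (m : ℕ) (x : EuclideanSpace ℝ (Fin d)) :
    ‖x - toEuclideanLin (headProjector v m) x‖ ^ 2
      = ∑ i, ∑ j, (1 - headProjector v m) i j * (x j * x i) := by
  set P := headProjector v m with hP
  have h1 : ‖x - toEuclideanLin P x‖ ^ 2
      = ((1 - P) *ᵥ x.ofLp) ⬝ᵥ ((1 - P) *ᵥ x.ofLp) := by
    rw [EuclideanSpace.real_norm_sq_eq]
    simp [dotProduct, sub_mulVec, toLpLin_apply, sq]
  have hT : (1 - P)ᵀ = 1 - P := by
    rw [transpose_sub, transpose_one, hP, headProjector_transpose]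
  have hI : (1 - P) * (1 - P) = 1 - P := by
    rw [sub_mul, mul_sub, mul_sub, hP, headProjector_mul_self]
    simp
  rw [h1, dotProduct_mulVec, vecMul_mulVec, hT, hI, dotProduct]
  simp only [vecMul, dotProduct, Finset.sum_mul]
  rw [Finset.sum_comm]
  refine Finset.sum_congr rfl fun i _ => Finset.sum_congr rfl fun j _ => ?_
  ring

theorem risk_headProjector (hX : MemLp X 2 μ)
    (v : OrthonormalBasis (Fin d) ℝ (EuclideanSpace ℝ (Fin d))) (m : ℕ) :
    risk X μ (headProjector v m)
      = (secondMoment X μ).trace - (headProjector v m * secondMoment X μ).trace := by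
  have hint : ∀ i j, Integrable
      (fun ω => (1 - headProjector v m) i j * (X ω j * X ω i)) μ :=
    fun i j => (integrable_coord_mul hX j i).const_mul _
  have h : (secondMoment X μ).trace - (headProjector v m * secondMoment X μ).trace
      = ((1 - headProjector v m) * secondMoment X μ).trace := by
    rw [sub_mul, one_mul, trace_sub]
  rw [h]
  simp only [risk, norm_sub_headProjector_sq]
  rw [integral_finsetSum _ fun i _ => integrable_finsetSum _ fun j _ => hint i j]
  simp only [trace, diag_apply, mul_apply]
  refine Finset.sum_congr rfl fun i _ => ?_
  rw [integral_finsetSum _ fun j _ => hint i j]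
  refine Finset.sum_congr rfl fun j _ => ?_
  rw [integral_const_mul]
  rfl

/-- Only `k = 4` along coordinate directions is needed; the factor `2` is `√4`. -/
theorem IsSubGaussian.eLpNorm_four_coord_le (h : IsSubGaussian X C μ) (i : Fin d) :
    eLpNorm (fun ω => X ω i) 4 μ ≤ 2 * (C * eLpNorm (fun ω => X ω i) 2 μ) := by
  have h1 := h.moment_le (EuclideanSpace.single i 1)
  have h2 := (le_iSup₂ (f := fun (k : ℕ) (_ : 1 ≤ k) =>
    ENNReal.ofReal ((k : ℝ) ^ (-(1 / 2) : ℝ)) *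
      eLpNorm (fun ω => inner ℝ (X ω) (EuclideanSpace.single i (1 : ℝ))) (k : ℝ≥0∞) μ)
    4 (by norm_num)).trans h1
  have h3 : ((4 : ℕ) : ℝ) ^ (-(1 / 2) : ℝ) = 2⁻¹ := by
    rw [Real.rpow_neg (by norm_num), ← Real.sqrt_eq_rpow,
      show ((4 : ℕ) : ℝ) = 2 ^ 2 by norm_num, Real.sqrt_sq (by norm_num)]
  rw [h3, ENNReal.ofReal_inv_of_pos (by norm_num)] at h2
  simp only [EuclideanSpace.inner_single_right, one_mul, conj_trivial, Nat.cast_ofNat,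
    ENNReal.ofReal_ofNat] at h2
  calc eLpNorm (fun ω => X ω i) 4 μ
      = 2 * (2⁻¹ * eLpNorm (fun ω => X ω i) 4 μ) := by
        rw [← mul_assoc, ENNReal.mul_inv_cancel (by norm_num) (by norm_num), one_mul]
    _ ≤ _ := by gcongr

theorem IsSubGaussian.memLp_four_coord (h : IsSubGaussian X C μ) (i : Fin d) :
    MemLp (fun ω => X ω i) 4 μ := by
  have h2 := memLp_coord h.memLp_two i
  refine ⟨h2.1, (h.eLpNorm_four_coord_le i).trans_lt ?_⟩
  exact ENNReal.mul_lt_top (by norm_num) (ENNReal.mul_lt_top ENNReal.coe_lt_top h2.2)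

theorem IsSubGaussian.integral_coord_pow_four_le (h : IsSubGaussian X C μ) (i : Fin d) :
    ∫ ω, X ω i ^ 4 ∂μ ≤ 16 * (C : ℝ) ^ 4 * (∫ ω, X ω i ^ 2 ∂μ) ^ 2 := by
  have h4 := h.eLpNorm_four_coord_le i
  set a := ∫ ω, X ω i ^ 4 ∂μ
  set b := ∫ ω, X ω i ^ 2 ∂μ
  have ha : 0 ≤ a := integral_nonneg fun ω => by positivity
  have hb : 0 ≤ b := integral_nonneg fun ω => by positivity
  have e4 : eLpNorm (fun ω => X ω i) 4 μ = ENNReal.ofReal (a ^ (1 / 4 : ℝ)) := by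
    rw [(h.memLp_four_coord i).eLpNorm_eq_integral_rpow_norm (by norm_num) (by norm_num)]
    have : ∀ x : ℝ, |x| ^ (4 : ℝ) = x ^ 4 := fun x => by
      rw [show (4 : ℝ) = ((4 : ℕ) : ℝ) by norm_num, Real.rpow_natCast]
      exact Even.pow_abs (by decide) x
    simp [this, a]
  have e2 : eLpNorm (fun ω => X ω i) 2 μ = ENNReal.ofReal (b ^ (1 / 2 : ℝ)) := by
    rw [(memLp_coord h.memLp_two i).eLpNorm_eq_integral_rpow_norm (by norm_num) (by norm_num)]
    simp [b]
  rw [e4, e2, ← ENNReal.ofReal_coe_nnreal, ← ENNReal.ofReal_mul C.coe_nonneg,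
    ← ENNReal.ofReal_ofNat 2, ← ENNReal.ofReal_mul (by norm_num),
    ENNReal.ofReal_le_ofReal_iff (by positivity)] at h4
  have h5 := pow_le_pow_left₀ (by positivity) h4 4
  have ea : (a ^ (1 / 4 : ℝ)) ^ 4 = a := by
    rw [← Real.rpow_natCast, ← Real.rpow_mul ha]
    norm_num
  have eb : (b ^ (1 / 2 : ℝ)) ^ 2 = b := by
    rw [← Real.rpow_natCast, ← Real.rpow_mul hb]
    norm_num
  rw [ea] at h5
  refine h5.trans_eq ?_
  calc _ = 16 * (C : ℝ) ^ 4 * ((b ^ (1 / 2 : ℝ)) ^ 2) ^ 2 := by ring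
    _ = _ := by rw [eb]

theorem IsSubGaussian.memLp_coord_mul (h : IsSubGaussian X C μ) (i j : Fin d) :
    MemLp (fun ω => X ω i * X ω j) 2 μ := by
  have : ENNReal.HolderTriple 4 4 2 := ⟨by
    rw [← ENNReal.toReal_eq_toReal_iff' (by norm_num) (by norm_num),
      ENNReal.toReal_add (by norm_num) (by norm_num)]
    norm_num⟩
  exact (h.memLp_four_coord j).mul' (h.memLp_four_coord i)

/-- Cauchy–Schwarz splits the mixed moment into two fourth moments. -/
theorem IsSubGaussian.integral_coord_mul_sq_le (h : IsSubGaussian X C μ) (i j : Fin d) :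
    ∫ ω, (X ω i * X ω j) ^ 2 ∂μ
      ≤ 16 * (C : ℝ) ^ 4 * ((∫ ω, X ω i ^ 2 ∂μ) * ∫ ω, X ω j ^ 2 ∂μ) := by
  have hsq : ∀ k, MemLp (fun ω => X ω k ^ 2) 2 μ := fun k => by
    simpa only [sq] using h.memLp_coord_mul k k
  have h1 := integral_mul_le_Lp_mul_Lq_of_nonneg (μ := μ) (p := 2) (q := 2)
    Real.HolderConjugate.two_two (f := fun ω => X ω i ^ 2) (g := fun ω => X ω j ^ 2)
    (.of_forall fun ω => sq_nonneg _) (.of_forall fun ω => sq_nonneg _)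
    (by simpa using hsq i) (by simpa using hsq j)
  simp only [Real.rpow_two, ← pow_mul, ← Real.sqrt_eq_rpow, ← mul_pow] at h1
  norm_num only at h1
  refine h1.trans ?_
  have hs : ∀ k, √(∫ ω, X ω k ^ 4 ∂μ) ≤ 4 * (C : ℝ) ^ 2 * ∫ ω, X ω k ^ 2 ∂μ := fun k => by
    have hb : 0 ≤ ∫ ω, X ω k ^ 2 ∂μ := integral_nonneg fun ω => by positivity
    refine Real.sqrt_le_iff.mpr ⟨by positivity, ?_⟩
    exact (h.integral_coord_pow_four_le k).trans_eq (by ring)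
  calc _ ≤ (4 * (C : ℝ) ^ 2 * ∫ ω, X ω i ^ 2 ∂μ) * (4 * (C : ℝ) ^ 2 * ∫ ω, X ω j ^ 2 ∂μ) :=
        mul_le_mul (hs i) (hs j) (Real.sqrt_nonneg _) ((Real.sqrt_nonneg _).trans (hs i))
    _ = _ := by ring

/-! ### Fluctuations of the empirical matrix. -/

variable {n : ℕ} {Ω : Type*} [MeasurableSpace Ω] {Pr : Measure Ω}
  {Xs : Fin n → Ω → EuclideanSpace ℝ (Fin d)}

theorem identDistrib_coord_mul (hident : ∀ k, IdentDistrib (Xs k) X Pr μ) (k : Fin n)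
    (i j : Fin d) :
    IdentDistrib (fun ω => Xs k ω i * Xs k ω j) (fun ω => X ω i * X ω j) Pr μ :=
  (hident k).comp (u := fun x : EuclideanSpace ℝ (Fin d) => x i * x j) (by fun_prop)

theorem memLp_empiricalSecondMoment (hX : IsSubGaussian X C μ)
    (hident : ∀ k, IdentDistrib (Xs k) X Pr μ) (i j : Fin d) :
    MemLp (fun ω => empiricalSecondMoment (fun k => Xs k ω) i j) 2 Pr :=
  (memLp_finsetSum Finset.univ fun k _ =>
    ((identDistrib_coord_mul hident k i j).memLp_iff.mpr
      (hX.memLp_coord_mul i j))).const_mul _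

theorem integral_empiricalSecondMoment (hn : 0 < n) (hX : MemLp X 2 μ)
    (hident : ∀ k, IdentDistrib (Xs k) X Pr μ) (i j : Fin d) :
    ∫ ω, empiricalSecondMoment (fun k => Xs k ω) i j ∂Pr = secondMoment X μ i j := by
  simp only [empiricalSecondMoment, secondMoment, of_apply]
  rw [integral_const_mul, integral_finsetSum _ fun k _ =>
    (identDistrib_coord_mul hident k i j).integrable_iff.mpr (integrable_coord_mul hX i j)]
  simp only [(identDistrib_coord_mul hident _ i j).integral_eq]
  have : (n : ℝ) ≠ 0 := by positivity
  simp [this]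

theorem variance_empiricalSecondMoment_le (hn : 0 < n) [IsProbabilityMeasure μ]
    (hX : IsSubGaussian X C μ)
    (hindep : iIndepFun Xs Pr) (hident : ∀ k, IdentDistrib (Xs k) X Pr μ) (i j : Fin d) :
    Var[fun ω => empiricalSecondMoment (fun k => Xs k ω) i j; Pr]
      ≤ 16 * (C : ℝ) ^ 4 * (secondMoment X μ i i * secondMoment X μ j j) / n := by
  have hn' : (n : ℝ) ≠ 0 := by positivity
  have hY : ∀ k, MemLp (fun ω => Xs k ω i * Xs k ω j) 2 Pr := fun k =>
    (identDistrib_coord_mul hident k i j).memLp_iff.mpr (hX.memLp_coord_mul i j)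
  have hsum : Var[fun ω => ∑ k, Xs k ω i * Xs k ω j; Pr]
      = n * Var[fun ω => X ω i * X ω j; μ] := by
    have h := IndepFun.variance_sum (μ := Pr) (s := Finset.univ)
      (X := fun k ω => Xs k ω i * Xs k ω j) (fun k _ => hY k) (fun k _ k' _ hkk' =>
        (hindep.indepFun hkk').comp
          (φ := fun x : EuclideanSpace ℝ (Fin d) => x i * x j)
          (ψ := fun x : EuclideanSpace ℝ (Fin d) => x i * x j) (by fun_prop) (by fun_prop))
    simp only [(identDistrib_coord_mul hident _ i j).variance_eq] at h
    rw [Finset.sum_const, Finset.card_univ, Fintype.card_fin, nsmul_eq_mul] at h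
    rw [← h]
    congr 1
    ext ω
    simp
  have hvar : Var[fun ω => X ω i * X ω j; μ] ≤ ∫ ω, (X ω i * X ω j) ^ 2 ∂μ :=
    variance_le_expectation_sq (hX.memLp_coord_mul i j).1
  simp only [empiricalSecondMoment, of_apply]
  rw [variance_const_mul, hsum]
  have hb := hvar.trans (hX.integral_coord_mul_sq_le i j)
  simp only [secondMoment, of_apply, ← sq]
  calc _ = Var[fun ω => X ω i * X ω j; μ] / n := by field_simp
    _ ≤ _ := by gcongr

variable [IsProbabilityMeasure Pr]

theorem integrable_sq_empiricalSecondMoment_sub (hX : IsSubGaussian X C μ)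
    (hident : ∀ k, IdentDistrib (Xs k) X Pr μ) (i j : Fin d) :
    Integrable (fun ω => (empiricalSecondMoment (fun k => Xs k ω) - secondMoment X μ) i j ^ 2)
      Pr :=
  ((memLp_empiricalSecondMoment hX hident i j).sub (memLp_const _)).integrable_sq

theorem integrable_frobSq (hX : IsSubGaussian X C μ)
    (hident : ∀ k, IdentDistrib (Xs k) X Pr μ) :
    Integrable (fun ω => frobSq (empiricalSecondMoment (fun k => Xs k ω) - secondMoment X μ))
      Pr :=
  integrable_finsetSum _ fun i _ => integrable_finsetSum _ fun j _ =>
    integrable_sq_empiricalSecondMoment_sub hX hident i j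

/-- Each entry is unbiased, so its mean squared error is a variance; the products of diagonal
entries sum to the squared trace. -/
theorem integral_frobSq_le (hn : 0 < n) [IsProbabilityMeasure μ] (hX : IsSubGaussian X C μ)
    (hindep : iIndepFun Xs Pr) (hident : ∀ k, IdentDistrib (Xs k) X Pr μ) :
    ∫ ω, frobSq (empiricalSecondMoment (fun k => Xs k ω) - secondMoment X μ) ∂Pr
      ≤ 16 * (C : ℝ) ^ 4 * (secondMoment X μ).trace ^ 2 / n := by
  have hint := integrable_sq_empiricalSecondMoment_sub (μ := μ) hX hident
  simp only [frobSq]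
  rw [integral_finsetSum _ fun i _ => integrable_finsetSum _ fun j _ => hint i j]
  have hr : 16 * (C : ℝ) ^ 4 * (secondMoment X μ).trace ^ 2 / n
      = ∑ i, ∑ j, 16 * (C : ℝ) ^ 4 * (secondMoment X μ i i * secondMoment X μ j j) / n := by
    simp only [← Finset.sum_div, ← Finset.mul_sum, ← Finset.sum_mul, sq, trace, diag_apply]
  rw [hr]
  refine Finset.sum_le_sum fun i _ => ?_
  rw [integral_finsetSum _ fun j _ => hint i j]
  refine Finset.sum_le_sum fun j _ => ?_
  refine le_trans (le_of_eq ?_)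
    (variance_empiricalSecondMoment_le hn hX hindep hident i j)
  rw [variance_eq_integral (memLp_empiricalSecondMoment hX hident i j).aemeasurable,
    integral_empiricalSecondMoment hn hX.memLp_two hident]
  rfl

/-- Jensen for the square root, read off from the nonnegativity of the variance of `√f`. -/
theorem integral_sqrt_le {f : Ω → ℝ} (hf : Integrable f Pr) (h0 : ∀ ω, 0 ≤ f ω) :
    Integrable (fun ω => √(f ω)) Pr ∧ ∫ ω, √(f ω) ∂Pr ≤ √(∫ ω, f ω ∂Pr) := by
  have hm : MemLp (fun ω => √(f ω)) 2 Pr := by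
    rw [memLp_two_iff_integrable_sq
      (Real.continuous_sqrt.comp_aestronglyMeasurable hf.aestronglyMeasurable)]
    simpa only [Real.sq_sqrt (h0 _)] using hf
  refine ⟨hm.integrable (by norm_num), Real.le_sqrt_of_sq_le ?_⟩
  have h := variance_nonneg (fun ω => √(f ω)) Pr
  rw [variance_eq_sub hm] at h
  simp only [Pi.pow_apply, Real.sq_sqrt (h0 _)] at h
  linarith

end Probability

end PCA

/-! ### Slow and fast rates in expectation. -/

theorem mainTheorem7 {d n d' : ℕ} (hn : 0 < n) (hd'1 : 1 ≤ d') (hd' : d' ≤ d)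
    {Ω₀ : Type*} [MeasurableSpace Ω₀] (μ : Measure Ω₀) [IsProbabilityMeasure μ]
    (X : Ω₀ → EuclideanSpace ℝ (Fin d)) (Csg : ℝ≥0) (hX : PCA.IsSubGaussian X Csg μ)
    {Ω : Type*} [MeasurableSpace Ω] (Pr : Measure Ω) [IsProbabilityMeasure Pr]
    (Xs : Fin n → Ω → EuclideanSpace ℝ (Fin d))
    (hindep : iIndepFun Xs Pr) (hident : ∀ k, IdentDistrib (Xs k) X Pr μ)
    (Phat : Ω → Matrix (Fin d) (Fin d) ℝ)
    (hmeas : ∀ i j, AEMeasurable (fun ω => Phat ω i j) Pr)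
    (hPhat : ∀ᵐ ω ∂Pr,
      PCA.IsPCAProjector (PCA.empiricalSecondMoment fun k => Xs k ω) d' (Phat ω))
    (lam : ℕ → ℝ) (hlam : lam = PCA.eigenvalue (PCA.secondMoment_isHermitian X μ))
    (ε : ℝ) (hε : 0 ≤ ε) (hdecay : lam (d' + 1) ≤ ε) :
    Integrable (fun ω => PCA.risk X μ (Phat ω)) Pr ∧
    ∫ ω, PCA.risk X μ (Phat ω) ∂Pr
      ≤ 8 * (Csg : ℝ) ^ 2 * √(d' : ℝ) * (PCA.secondMoment X μ).trace / √(n : ℝ)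
        + ε * ((d : ℝ) - (d' : ℝ)) ∧
    (lam (d' + 1) < lam d' →
      ∫ ω, PCA.risk X μ (Phat ω) ∂Pr
        ≤ min (8 * (Csg : ℝ) ^ 2 * √(d' : ℝ) * (PCA.secondMoment X μ).trace / √(n : ℝ))
            (64 * (Csg : ℝ) ^ 4 * (PCA.secondMoment X μ).trace ^ 2
              / ((n : ℝ) * (lam d' - lam (d' + 1))))
          + ε * ((d : ℝ) - (d' : ℝ))) := by
  obtain ⟨v, l, hl, hA, hlv⟩ := PCA.exists_sorted_eigenbasis (PCA.secondMoment_isHermitian X μ)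
  rw [← hlam] at hlv
  set S := PCA.secondMoment X μ with hS
  set F : Ω → ℝ := fun ω => PCA.frobSq (PCA.empiricalSecondMoment (fun k => Xs k ω) - S) with hF
  have hFint : Integrable F Pr := PCA.integrable_frobSq hX hident
  have hF0 : ∀ ω, 0 ≤ F ω := fun ω => PCA.frobSq_nonneg _
  have hFle : ∫ ω, F ω ∂Pr ≤ 16 * (Csg : ℝ) ^ 4 * S.trace ^ 2 / n :=
    PCA.integral_frobSq_le hn hX hindep hident
  obtain ⟨hsint, hsle⟩ := PCA.integral_sqrt_le hFint hF0
  have hn' : (0 : ℝ) < n := by exact_mod_cast hn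
  have htr : 0 ≤ S.trace := Finset.sum_nonneg fun i _ =>
    integral_nonneg fun ω => mul_self_nonneg _
  have hbias : S.trace - (PCA.headProjector v d' * S).trace ≤ ε * ((d : ℝ) - d') := by
    rw [PCA.trace_sub_headProjector_mul hA]
    have hcard : ((Finset.univ.filter fun i : Fin d => ¬ i.val < d').card : ℝ) = d - d' := by
      rw [Finset.filter_not, Finset.card_sdiff_of_subset (Finset.filter_subset _ _),
        Finset.card_univ, Fintype.card_fin, Fin.card_filter_val_lt, min_eq_right hd',
        Nat.cast_sub hd']
    rw [← hcard, mul_comm, ← nsmul_eq_mul]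
    refine Finset.sum_le_card_nsmul _ _ _ fun i hi => ?_
    have hi' : d' ≤ i.val := by simpa using hi
    -- Zero-based index `d'` carries the `(d' + 1)`-st eigenvalue; for `d' = d` the tail sum is
    -- empty.
    have h := hl (show (⟨d', by omega⟩ : Fin d) ≤ i from hi')
    rw [← hlv ⟨d', by omega⟩] at h
    exact h.trans hdecay
  -- Almost surely, the excess risk satisfies both the slow and the fast bound.
  have hpt : ∀ᵐ ω ∂Pr, PCA.risk X μ (Phat ω) = S.trace - (Phat ω * S).trace ∧
      PCA.risk X μ (Phat ω) ≤ √(2 * d') * √(F ω) + ε * ((d : ℝ) - d') ∧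
      (lam (d' + 1) < lam d' →
        PCA.risk X μ (Phat ω) ≤ 2 / (lam d' - lam (d' + 1)) * F ω + ε * ((d : ℝ) - d')) := by
    filter_upwards [hPhat] with ω hω
    obtain ⟨u, l', hl', hB, hP⟩ := hω
    have hP' : Phat ω = PCA.headProjector u d' := hP
    have hB' : ∀ i, Matrix.mulVec (PCA.empiricalSecondMoment fun k => Xs k ω) (u i).ofLp
        = l' i • (u i).ofLp := fun i => congrArg WithLp.ofLp (hB i)
    have hrisk := PCA.risk_headProjector hX.memLp_two u d'
    rw [← hS] at hrisk
    obtain ⟨hx0, hx⟩ := PCA.excess_sq_le hd'1 hd' hl hA hl' hB'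
    have ht := PCA.trace_mul_headProjector_nonneg (m := d') u v
    rw [hP', hrisk]
    set x := (PCA.headProjector v d' * S).trace - (PCA.headProjector u d' * S).trace with hxdef
    set t := (PCA.headProjector u d' * PCA.headProjector v d').trace
    change x ^ 2 ≤ F ω * (2 * (d' - t)) at hx
    refine ⟨rfl, ?_, fun hgap => ?_⟩
    · have : x ≤ √(2 * d') * √(F ω) := by
        rw [← Real.sqrt_mul (by positivity)]
        refine Real.le_sqrt_of_sq_le (hx.trans ?_)
        nlinarith [mul_nonneg (hF0 ω) ht]
      linarith
    · have hg : 0 < lam d' - lam (d' + 1) := by linarith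
      have hgx := PCA.mul_gap_le_trace_sub u hd' hA (a := lam d') (b := lam (d' + 1))
        (fun i hi => by
          have h := hlv ⟨d' - 1, by omega⟩
          rw [show d' - 1 + 1 = d' by omega] at h
          rw [h]
          exact hl (Fin.mk_le_mk.mpr (by omega : i.val ≤ d' - 1)))
        (fun i hi => by
          rw [hlv ⟨d', by omega⟩]
          exact hl (Fin.mk_le_mk.mpr hi))
      have : x ≤ 2 / (lam d' - lam (d' + 1)) * F ω := by
        rw [div_mul_eq_mul_div, le_div_iff₀ hg]
        rcases hx0.eq_or_lt with h0 | h0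
        -- Cancelling a factor `x` needs `x > 0`, so `x = 0` is treated apart.
        · rw [← h0, zero_mul]
          linarith [hF0 ω]
        · refine le_of_mul_le_mul_left ?_ h0
          calc x * (x * (lam d' - lam (d' + 1))) = x ^ 2 * (lam d' - lam (d' + 1)) := by ring
            _ ≤ F ω * (2 * (d' - t)) * (lam d' - lam (d' + 1)) := by gcongr
            _ = 2 * F ω * ((lam d' - lam (d' + 1)) * (d' - t)) := by ring
            _ ≤ 2 * F ω * x := mul_le_mul_of_nonneg_left hgx (by linarith [hF0 ω])
            _ = x * (2 * F ω) := by ring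
      linarith
  have hslow : Integrable (fun ω => √(2 * d') * √(F ω) + ε * ((d : ℝ) - d')) Pr :=
    (hsint.const_mul _).add (integrable_const _)
  have hint : Integrable (fun ω => PCA.risk X μ (Phat ω)) Pr := by
    refine hslow.mono' ?_ ?_
    -- Almost surely the risk is affine in the entries of `Phat`, which gives its measurability.
    · have hm : AEMeasurable (fun ω => S.trace - (Phat ω * S).trace) Pr := by
        simp only [Matrix.trace, Matrix.diag_apply, Matrix.mul_apply]
        fun_prop
      refine (hm.congr ?_).aestronglyMeasurable
      filter_upwards [hpt] with ω h using h.1.symm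
    · filter_upwards [hpt] with ω h
      rw [Real.norm_of_nonneg (show 0 ≤ PCA.risk X μ (Phat ω) from
        integral_nonneg fun _ => sq_nonneg _)]
      exact h.2.1
  have hbound1 : ∫ ω, PCA.risk X μ (Phat ω) ∂Pr
      ≤ 8 * (Csg : ℝ) ^ 2 * √(d' : ℝ) * S.trace / √(n : ℝ) + ε * ((d : ℝ) - d') := by
    refine (integral_mono_ae hint hslow (hpt.mono fun ω h => h.2.1)).trans ?_
    rw [integral_add (hsint.const_mul _) (integrable_const _), integral_const_mul]
    simp only [integral_const, probReal_univ, one_smul]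
    have hroot : √(16 * (Csg : ℝ) ^ 4 * S.trace ^ 2 / n) = 4 * (Csg : ℝ) ^ 2 * S.trace / √n := by
      rw [Real.sqrt_div (by positivity),
        show 16 * (Csg : ℝ) ^ 4 * S.trace ^ 2 = (4 * (Csg : ℝ) ^ 2 * S.trace) ^ 2 by ring,
        Real.sqrt_sq (by positivity)]
    -- Rounding `√2` up to `2` produces the constant `8 = 2 * 4`.
    have h2 : √(2 * (d' : ℝ)) ≤ 2 * √d' := by
      rw [Real.sqrt_mul (by norm_num)]
      gcongr
      exact Real.sqrt_le_iff.mpr ⟨by norm_num, by norm_num⟩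
    gcongr
    calc √(2 * (d' : ℝ)) * ∫ ω, √(F ω) ∂Pr
        ≤ 2 * √d' * (4 * (Csg : ℝ) ^ 2 * S.trace / √n) :=
          mul_le_mul h2 (hsle.trans ((Real.sqrt_le_sqrt hFle).trans_eq hroot))
            (integral_nonneg fun _ => Real.sqrt_nonneg _) (by positivity)
      _ = _ := by ring
  refine ⟨hint, hbound1, fun hgap => ?_⟩
  have hg : 0 < lam d' - lam (d' + 1) := by linarith
  rw [min_add]
  refine le_min hbound1 ?_
  refine (integral_mono_ae hint ((hFint.const_mul _).add (integrable_const _))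
    (hpt.mono fun ω h => h.2.2 hgap)).trans ?_
  rw [integral_add' (hFint.const_mul _) (integrable_const _), integral_const_mul]
  simp only [integral_const, probReal_univ, one_smul]
  gcongr
  calc 2 / (lam d' - lam (d' + 1)) * ∫ ω, F ω ∂Pr
      ≤ 2 / (lam d' - lam (d' + 1)) * (16 * (Csg : ℝ) ^ 4 * S.trace ^ 2 / n) := by gcongr
    _ = 32 * (Csg : ℝ) ^ 4 * S.trace ^ 2 / (n * (lam d' - lam (d' + 1))) := by
        rw [div_mul_div_comm]
        congr 1 <;> ring
    -- The argument gives `32`; the stated `64` is weaker.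
    _ ≤ _ := by
        gcongr
        norm_num
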